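/- An explicit two-derivative multistage method with $s$ stages is given by real strictly lower triangular $s\times s$ matrices $A=(a_{ij})$, $\hat A=(\hat a_{ij})$ and vectors $b,\hat b\in\mathbb R^s$. One step of size $\Delta t$ from $u^n$ is $$y^{(i)}=u^n+\Delta t\sum_{j=1}^{i-1}a_{ij}F(y^{(j)})+\Delta t^2\sum_{j=1}^{i-1}\hat a_{ij}\dot F(y^{(j)})\quad(1\le i\le s),$$ $$u^{n+1}=u^n+\Delta t\sum_{j=1}^{s}b_jF(y^{(j)})+\Delta t^2\sum_{j=1}^{s}\hat b_j\dot F(y^{(j)}).$$ * The method has order (at least) $p$ if for every $d$, every smooth $F:\mathbb R^d\to\mathbb R^d$, with $\dot F(v)=F'(v)F(v)$, and every local solution $u$ of $u'=F(u)$ near $t=0$, one step of size $h$ started at $u(0)$ differs from $u(h)$ by $O(h^{p+1})$ as $h\to0^+$. * The method is irreducible if there is no partition $\{1,\dots,s\}=T_1\cup T_2$, $T_1\cap T_2=\emptyset$, $T_1\ne\emptyset$, with $b_j=\hat b_j=0$ for $j\in T_1$ and $a_{ij}=\hat a_{ij}=0$ for $i\in T_2$, $j\in T_1$. * Put $S=\begin{pmatrix}A&0\\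 b^T&0\end{pmatrix}$, $\hat S=\begin{pmatrix}\hat A&0\\ \hat b^T&0\end{pmatrix}$ and, for $K,r>0$, $R=\bigl(I+rS+\tfrac{2r^2}{K^2}(1-K)\hat S\bigr)^{-1}$. The method is SSP-TS (strong stability preserving Taylor series) for the ratio $K>0$ of the Taylor series time step to the forward Euler time step if there is $r_{\max}>0$ such that, for all $r\in(0,r_{\max}]$, componentwise, $$R\,\mathbf e\ge0,\qquad rR\bigl(S-\tfrac{2r}{K}\hat S\bigr)\ge0,\qquad \tfrac{2r^2}{K^2}R\hat S\ge0,$$ where $\mathbf e$ is the vector of ones. Theorem. Let $K>0$. No irreducible explicit SSP-TS two-derivative multistage method, with any number of stages, has order $7$. Consequently, if such a method has order $p$, then $p\le 6$. -/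

import Mathlib

open Matrix Filter Topology Asymptotics
open scoped ContDiff

/-- The coefficients of an explicit two-derivative multistage method with `s` stages: matrices
`A`, `Ahat` that are strictly lower triangular, and weights `b`, `bhat`. -/
structure TwoDerivativeMethod (s : ℕ) where
  A : Matrix (Fin s) (Fin s) ℝ
  Ahat : Matrix (Fin s) (Fin s) ℝ
  b : Fin s → ℝ
  bhat : Fin s → ℝ
  A_explicit : ∀ i j, i ≤ j → A i j = 0
  Ahat_explicit : ∀ i j, i ≤ j → Ahat i j = 0

namespace TwoDerivativeMethod

variable {s : ℕ}

/-- The stage values, computed one after the other: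
`y⁽ⁱ⁾ = u + h ∑_{j < i} a_{ij} F(y⁽ʲ⁾) + h² ∑_{j < i} â_{ij} G(y⁽ʲ⁾)`.
Here `G` plays the role of the second time derivative. The first stage is `u`. -/
noncomputable def stage (m : TwoDerivativeMethod s) {E : Type*} [AddCommGroup E] [Module ℝ E]
    (F G : E → E) (h : ℝ) (u : E) (i : Fin s) : E :=
  u + h • ∑ j : {j : Fin s // j < i}, m.A i j.1 • F (stage m F G h u j.1)
    + h ^ 2 • ∑ j : {j : Fin s // j < i}, m.Ahat i j.1 • G (stage m F G h u j.1)
termination_by i.val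
decreasing_by all_goals exact j.2

/-- One step of the method:
`u⁺ = u + h ∑_j b_j F(y⁽ʲ⁾) + h² ∑_j b̂_j G(y⁽ʲ⁾)`. -/
noncomputable def step (m : TwoDerivativeMethod s) {E : Type*} [AddCommGroup E] [Module ℝ E]
    (F G : E → E) (h : ℝ) (u : E) : E :=
  u + h • ∑ j, m.b j • F (m.stage F G h u j)
    + h ^ 2 • ∑ j, m.bhat j • G (m.stage F G h u j)

/-- The method has order (at least) `p`: for every smooth autonomous system `u' = F(u)` in
`ℝᵈ` and every local solution `u`, one step started at `u(0)`, taken with the exact second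
derivative `Ḟ(v) = F'(v) F(v)`, has local error `O(h^{p+1})` as `h → 0⁺`. -/
def HasOrder (m : TwoDerivativeMethod s) (p : ℕ) : Prop :=
  ∀ (d : ℕ) (F : (Fin d → ℝ) → (Fin d → ℝ)), ContDiff ℝ ∞ F →
    ∀ u : ℝ → (Fin d → ℝ), (∀ᶠ t in 𝓝 (0 : ℝ), HasDerivAt u (F (u t)) t) →
      (fun h : ℝ => m.step F (fun v => fderiv ℝ F v (F v)) h (u 0) - u h)
        =O[𝓝[>] (0 : ℝ)] fun h : ℝ => h ^ (p + 1)

/-- DJ-reducibility (Dahlquist and Jeltsch): there is a nonempty set `T₁` of stages that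
influence neither the new value nor the remaining stages `T₂`. -/
def IsDJReducible (m : TwoDerivativeMethod s) : Prop :=
  ∃ T₁ T₂ : Set (Fin s), T₁.Nonempty ∧ T₁ ∩ T₂ = ∅ ∧ T₁ ∪ T₂ = Set.univ ∧
    (∀ j ∈ T₁, m.b j = 0 ∧ m.bhat j = 0) ∧
    (∀ i ∈ T₂, ∀ j ∈ T₁, m.A i j = 0 ∧ m.Ahat i j = 0)

def IsIrreducible (m : TwoDerivativeMethod s) : Prop := ¬ m.IsDJReducible

/-- The block matrix `S = [A 0; bᵀ 0]` of size `s + 1`. -/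
def S (m : TwoDerivativeMethod s) : Matrix (Fin s ⊕ Unit) (Fin s ⊕ Unit) ℝ :=
  Matrix.fromBlocks m.A 0 (Matrix.of fun _ j => m.b j) 0

/-- The block matrix `Ŝ = [Â 0; b̂ᵀ 0]` of size `s + 1`. -/
def Shat (m : TwoDerivativeMethod s) : Matrix (Fin s ⊕ Unit) (Fin s ⊕ Unit) ℝ :=
  Matrix.fromBlocks m.Ahat 0 (Matrix.of fun _ j => m.bhat j) 0

/-- The matrix `R = (I + r S + (2 r² / K²) (1 - K) Ŝ)⁻¹`. The matrix inverted is unit lower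
triangular, see `det_shuOsher`. -/
noncomputable def R (m : TwoDerivativeMethod s) (K r : ℝ) :
    Matrix (Fin s ⊕ Unit) (Fin s ⊕ Unit) ℝ :=
  (1 + r • m.S + (2 * r ^ 2 / K ^ 2 * (1 - K)) • m.Shat)⁻¹

/-- The componentwise conditions `R e ≥ 0`, `r R (S - (2 r / K) Ŝ) ≥ 0` and
`(2 r² / K²) R Ŝ ≥ 0`, which make the method a convex combination of forward Euler steps and
Taylor series steps. -/
def SSPConditions (m : TwoDerivativeMethod s) (K r : ℝ) : Prop :=
  (∀ i, 0 ≤ (m.R K r *ᵥ 1) i) ∧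
  (∀ i j, 0 ≤ (r • (m.R K r * (m.S - (2 * r / K) • m.Shat))) i j) ∧
  (∀ i j, 0 ≤ ((2 * r ^ 2 / K ^ 2) • (m.R K r * m.Shat)) i j)

/-- Strong stability preserving Taylor series method, for the ratio `K` between the
Taylor series time step and the forward Euler time step: the conditions hold for all
`r ∈ (0, rmax]`, for some positive `rmax`. -/
def IsSSPTS (m : TwoDerivativeMethod s) (K : ℝ) : Prop :=
  ∃ rmax : ℝ, 0 < rmax ∧ ∀ r ∈ Set.Ioc 0 rmax, m.SSPConditions K r

theorem det_shuOsher (m : TwoDerivativeMethod s) (x y : ℝ) :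
    (1 + x • m.S + y • m.Shat).det = 1 := by
  have h : 1 + x • m.S + y • m.Shat = Matrix.fromBlocks (1 + x • m.A + y • m.Ahat) 0
      (Matrix.of fun _ j => x * m.b j + y * m.bhat j) 1 := by
    ext (i | i) (j | j) <;> simp [S, Shat, Matrix.one_apply]
  rw [h, Matrix.det_fromBlocks_zero₁₂, Matrix.det_one, mul_one, Matrix.det_of_isLowerTriangular]
  · refine Finset.prod_eq_one fun i _ => ?_
    simp [m.A_explicit i i le_rfl, m.Ahat_explicit i i le_rfl]
  · intro i j hij
    have hij' : i < j := hij
    simp [hij'.ne, m.A_explicit i j hij'.le, m.Ahat_explicit i j hij'.le]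

/-- The stages satisfy the equations of the method with full sums. -/
theorem stage_eq (m : TwoDerivativeMethod s) {E : Type*} [AddCommGroup E] [Module ℝ E]
    (F G : E → E) (h : ℝ) (u : E) (i : Fin s) :
    m.stage F G h u i = u + h • ∑ j, m.A i j • F (m.stage F G h u j)
      + h ^ 2 • ∑ j, m.Ahat i j • G (m.stage F G h u j) := by
  have key : ∀ f : Fin s → E, (∀ j, i ≤ j → f j = 0) →
      ∑ j : {j : Fin s // j < i}, f j.1 = ∑ j, f j := by
    intro f hf
    rw [← Finset.sum_subtype (Finset.univ.filter fun j => j < i) (by simp) f]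
    refine Finset.sum_subset (Finset.subset_univ _) fun j _ hj => hf j ?_
    simpa using hj
  rw [stage]
  rw [key (fun j => m.A i j • F (m.stage F G h u j)) (fun j hj => by
      simp [m.A_explicit i j hj]),
    key (fun j => m.Ahat i j • G (m.stage F G h u j)) (fun j hj => by
      simp [m.Ahat_explicit i j hj])]

end TwoDerivativeMethod

/-! Positivity and high order collide, as in the classical order barriers for SSP methods. As `r →
0`, the SSP conditions give `S, Ŝ ≥ 0`, and a zero entry of `S` is also one of `Ŝ` and `S²`. So the
stages with `b_j = 0` would form a reducing set, and irreducibility gives `b > 0` (`IsSSPTS.b_pos`).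
Order seven on `testField` forces `∑ b_j ρ_j² = 0`, where `ρ_j` is the cubic residual of stage `j`;
hence every `ρ_j = 0`. In an explicit method this makes all abscissae vanish, which contradicts the
order condition with value `1 / 6`. -/

namespace TwoDerivativeMethod

/-! ### Small-`r` limits of the SSP conditions -/

section Positivity

variable {s : ℕ}

/-- The matrix `I + r S + (2 r² / K²) (1 - K) Ŝ`, the inverse of `R`. -/
noncomputable def shuOsherMatrix (m : TwoDerivativeMethod s) (K r : ℝ) :
    Matrix (Fin s ⊕ Unit) (Fin s ⊕ Unit) ℝ :=
  1 + r • m.S + (2 * r ^ 2 / K ^ 2 * (1 - K)) • m.Shat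

theorem shuOsherMatrix_mul_R (m : TwoDerivativeMethod s) (K r : ℝ) :
    m.shuOsherMatrix K r * m.R K r = 1 := by
  refine Matrix.mul_nonsing_inv _ ?_
  rw [shuOsherMatrix, m.det_shuOsher]
  exact isUnit_one

theorem continuous_R (m : TwoDerivativeMethod s) (K : ℝ) : Continuous (m.R K) := by
  have h : m.R K = fun r => (m.shuOsherMatrix K r).adjugate := by
    funext r
    rw [R, Matrix.inv_def, m.det_shuOsher, Ring.inverse_one, one_smul]
    rfl
  rw [h]
  refine Continuous.matrix_adjugate ?_
  unfold shuOsherMatrix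
  fun_prop

theorem R_zero (m : TwoDerivativeMethod s) (K : ℝ) : m.R K 0 = 1 := by
  simp [R]

/-- The weights of the forward Euler steps, divided by `r`. -/
noncomputable def eulerWeights (m : TwoDerivativeMethod s) (K r : ℝ) :
    Matrix (Fin s ⊕ Unit) (Fin s ⊕ Unit) ℝ :=
  m.R K r * (m.S - (2 * r / K) • m.Shat)

theorem continuous_eulerWeights (m : TwoDerivativeMethod s) (K : ℝ) :
    Continuous (m.eulerWeights K) := by
  have := m.continuous_R K
  unfold eulerWeights
  fun_prop

theorem eulerWeights_zero (m : TwoDerivativeMethod s) (K : ℝ) : m.eulerWeights K 0 = m.S := by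
  simp [eulerWeights, R_zero]

/-- Multiplying by the inverse of `R` and isolating `S` gives an exact expansion around `r = 0`,
whose remainder is `r` times a continuous function. -/
theorem eulerWeights_eq (m : TwoDerivativeMethod s) (K r : ℝ) :
    m.eulerWeights K r = m.S - r • ((2 / K) • m.Shat + m.S * m.eulerWeights K r
      + (2 * r / K ^ 2 * (1 - K)) • (m.Shat * m.eulerWeights K r)) := by
  have h : m.shuOsherMatrix K r * m.eulerWeights K r = m.S - (2 * r / K) • m.Shat := by
    rw [eulerWeights, ← Matrix.mul_assoc, shuOsherMatrix_mul_R, Matrix.one_mul]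
  rw [shuOsherMatrix, Matrix.add_mul, Matrix.add_mul, Matrix.one_mul, Matrix.smul_mul,
    Matrix.smul_mul] at h
  have h' := eq_sub_of_add_eq (eq_sub_of_add_eq h)
  ext i j
  have hij := congrFun (congrFun h' i) j
  simp only [Matrix.sub_apply, Matrix.add_apply, Matrix.smul_apply, smul_eq_mul] at hij ⊢
  rw [hij]
  ring

theorem nonneg_of_pos_near_zero {f : ℝ → ℝ} (hf : Continuous f) {ρ : ℝ} (hρ : 0 < ρ)
    (h : ∀ r ∈ Set.Ioc 0 ρ, 0 ≤ f r) : 0 ≤ f 0 := by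
  have hlim : Tendsto f (𝓝[>] 0) (𝓝 (f 0)) := hf.continuousAt.tendsto.mono_left nhdsWithin_le_nhds
  refine ge_of_tendsto hlim ?_
  filter_upwards [Ioc_mem_nhdsGT hρ] with r hr using h r hr

theorem IsSSPTS.eulerWeights_nonneg {m : TwoDerivativeMethod s} {K : ℝ} (h : m.IsSSPTS K) :
    ∃ ρ : ℝ, 0 < ρ ∧ ∀ r ∈ Set.Ioc 0 ρ, ∀ i j, 0 ≤ m.eulerWeights K r i j := by
  obtain ⟨ρ, hρ, hr⟩ := h
  refine ⟨ρ, hρ, fun r hr' i j => ?_⟩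
  have := (hr r hr').2.1 i j
  rw [Matrix.smul_apply, smul_eq_mul] at this
  exact nonneg_of_mul_nonneg_right this hr'.1

theorem IsSSPTS.S_nonneg {m : TwoDerivativeMethod s} {K : ℝ} (h : m.IsSSPTS K)
    (i j : Fin s ⊕ Unit) : 0 ≤ m.S i j := by
  obtain ⟨ρ, hρ, hr⟩ := h.eulerWeights_nonneg
  have := nonneg_of_pos_near_zero ((m.continuous_eulerWeights K).matrix_elem i j) hρ
    fun r hr' => hr r hr' i j
  rwa [eulerWeights_zero] at this

theorem IsSSPTS.Shat_nonneg {m : TwoDerivativeMethod s} {K : ℝ} (hK : 0 < K) (h : m.IsSSPTS K)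
    (i j : Fin s ⊕ Unit) : 0 ≤ m.Shat i j := by
  obtain ⟨ρ, hρ, hr⟩ := h
  have hc : Continuous fun r => m.R K r * m.Shat := (m.continuous_R K).matrix_mul continuous_const
  have := nonneg_of_pos_near_zero (hc.matrix_elem i j) hρ fun r hr' => by
    have h3 := (hr r hr').2.2 i j
    rw [Matrix.smul_apply, smul_eq_mul] at h3
    have hr0 := hr'.1
    exact nonneg_of_mul_nonneg_right h3 (by positivity)
  simpa [R_zero] using this

/-- A zero entry of `S` is also a zero entry of `Ŝ` and of `S²`. -/
theorem IsSSPTS.eq_zero_of_S_eq_zero {m : TwoDerivativeMethod s} {K : ℝ} (hK : 0 < K)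
    (h : m.IsSSPTS K) {i j : Fin s ⊕ Unit} (hij : m.S i j = 0) :
    m.Shat i j = 0 ∧ (m.S * m.S) i j = 0 := by
  obtain ⟨ρ, hρ, hr⟩ := h.eulerWeights_nonneg
  have hX := m.continuous_eulerWeights K
  have hc : Continuous fun r => -((2 / K) • m.Shat + m.S * m.eulerWeights K r
      + (2 * r / K ^ 2 * (1 - K)) • (m.Shat * m.eulerWeights K r)) := by
    fun_prop
  -- With `S i j = 0` the weight is `r` times the bracket. Dividing by `r` and letting `r → 0`
  -- leaves `-(2/K) Ŝ - S² ≥ 0` at this entry, where both terms subtracted are nonnegative.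
  have key := nonneg_of_pos_near_zero (hc.matrix_elem i j) hρ fun r hr' => by
    have h1 := hr r hr' i j
    rw [eulerWeights_eq, Matrix.sub_apply, Matrix.smul_apply, hij, zero_sub, smul_eq_mul,
      ← mul_neg] at h1
    exact nonneg_of_mul_nonneg_right h1 hr'.1
  have hSS : 0 ≤ (m.S * m.S) i j := by
    rw [Matrix.mul_apply]
    exact Finset.sum_nonneg fun k _ => mul_nonneg (h.S_nonneg _ _) (h.S_nonneg _ _)
  have hSh : 0 ≤ 2 / K * m.Shat i j := mul_nonneg (by positivity) (h.Shat_nonneg hK i j)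
  simp only [eulerWeights_zero, Matrix.neg_apply, Matrix.add_apply, Matrix.smul_apply,
    smul_eq_mul, mul_zero, zero_div, zero_mul, add_zero] at key
  refine ⟨?_, by linarith⟩
  have : 2 / K * m.Shat i j = 0 := by linarith
  exact (mul_eq_zero.1 this).resolve_left (by positivity)

theorem IsSSPTS.b_pos {m : TwoDerivativeMethod s} {K : ℝ} (hK : 0 < K) (h : m.IsSSPTS K)
    (hirr : m.IsIrreducible) (j : Fin s) : 0 < m.b j := by
  have hb : ∀ i, 0 ≤ m.b i := fun i => h.S_nonneg (Sum.inr ()) (Sum.inl i)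
  have hA : ∀ i k, 0 ≤ m.A i k := fun i k => h.S_nonneg (Sum.inl i) (Sum.inl k)
  refine lt_of_le_of_ne (hb j) fun hj => hirr ?_
  -- The last row of `S²` is `bᵀA`: if `b_k = 0`, then `∑ b_l a_{lk} = 0` with nonnegative terms, so
  -- `a_{ik} = 0` wherever `b_i ≠ 0`.
  refine ⟨{k | m.b k = 0}, {k | m.b k = 0}ᶜ, ⟨j, hj.symm⟩, Set.inter_compl_self _,
    Set.union_compl_self _, fun k hk => ⟨hk, ?_⟩, fun i hi k hk => ?_⟩
  · exact (h.eq_zero_of_S_eq_zero (i := Sum.inr ()) (j := Sum.inl k) hK hk).1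
  · have h2 := (h.eq_zero_of_S_eq_zero (i := Sum.inr ()) (j := Sum.inl k) hK hk).2
    have h3 : ∑ l, m.b l * m.A l k = 0 := by
      simpa [Matrix.mul_apply, S] using h2
    have h4 := (Finset.sum_eq_zero_iff_of_nonneg fun l _ => mul_nonneg (hb l) (hA l k)).1 h3 i
      (Finset.mem_univ i)
    have h5 : m.A i k = 0 := (mul_eq_zero.1 h4).resolve_left hi
    exact ⟨h5, (h.eq_zero_of_S_eq_zero (i := Sum.inl i) (j := Sum.inl k) hK h5).1⟩

end Positivity

/-! ### A test system for order seven -/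

section TestProblem

/-- The autonomous system `t' = 1`, `x' = t² / 2`, `z' = (x - t³ / 6)²`, with solution
`(t, t³ / 6, 0)`. One step from the origin puts into the last component the weighted sum of the
squares of the stage residuals of order three. -/
noncomputable def testField (v : Fin 3 → ℝ) : Fin 3 → ℝ :=
  ![1, v 0 ^ 2 / 2, (v 1 - v 0 ^ 3 / 6) ^ 2]

/-- The exact second time derivative along solutions of the test system. -/
noncomputable def testFieldDot (v : Fin 3 → ℝ) : Fin 3 → ℝ :=
  fderiv ℝ testField v (testField v)

theorem contDiff_testField : ContDiff ℝ ∞ testField := by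
  rw [contDiff_pi]
  intro i
  fin_cases i <;> simp [testField] <;> fun_prop

/-- The residual `x - t³ / 6` is a first integral of the field, so its square has zero derivative
along the flow. Hence `b̂` does not enter the last component of a step. -/
theorem testFieldDot_eq (v : Fin 3 → ℝ) : testFieldDot v = ![0, v 0, 0] := by
  have hd : DifferentiableAt ℝ testField v := contDiff_testField.differentiable (by simp) v
  have h1 := (hd.hasFDerivAt.hasLineDerivAt (testField v))
  refine HasLineDerivAt.unique h1 ?_
  rw [HasLineDerivAt, hasDerivAt_pi]
  have ht : HasDerivAt (fun τ : ℝ => v 0 + τ) 1 0 := (hasDerivAt_id (0 : ℝ)).const_add (v 0)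
  have hx : HasDerivAt (fun τ : ℝ => v 1 + τ * (v 0 ^ 2 / 2)) (v 0 ^ 2 / 2) 0 := by
    simpa using ((hasDerivAt_id (0 : ℝ)).mul_const (v 0 ^ 2 / 2)).const_add (v 1)
  intro i
  fin_cases i
  · simpa [testField] using hasDerivAt_const (0 : ℝ) (1 : ℝ)
  · have := (ht.pow 2).div_const 2
    simpa [testField] using this
  · have := (hx.sub ((ht.pow 3).div_const 6)).pow 2
    refine HasDerivAt.congr_deriv (f := fun τ => testField (v + τ • testField v) 2)
      (this.congr_of_eventuallyEq (Eventually.of_forall fun τ => ?_)) ?_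
    · simp [testField]
    · simp
      right
      ring

variable {s : ℕ}

/-- The abscissae `c = A e`. -/
def abscissa (m : TwoDerivativeMethod s) (i : Fin s) : ℝ := ∑ j, m.A i j

/-- The coefficient of `h³` in the stage values for `x' = t² / 2`. -/
noncomputable def cubicCoeff (m : TwoDerivativeMethod s) (i : Fin s) : ℝ :=
  ∑ j, m.A i j * (m.abscissa j ^ 2 / 2) + ∑ j, m.Ahat i j * m.abscissa j

theorem stage_testField_zero (m : TwoDerivativeMethod s) (h : ℝ) (i : Fin s) :
    m.stage testField testFieldDot h 0 i 0 = h * m.abscissa i := by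
  rw [stage_eq]
  simp [testFieldDot_eq, testField, abscissa]

theorem stage_testField_one (m : TwoDerivativeMethod s) (h : ℝ) (i : Fin s) :
    m.stage testField testFieldDot h 0 i 1 = h ^ 3 * m.cubicCoeff i := by
  rw [stage_eq]
  simp only [testFieldDot_eq, testField, cubicCoeff, Pi.add_apply, Pi.smul_apply,
    Finset.sum_apply, smul_eq_mul, Matrix.cons_val_one, Matrix.cons_val_zero,
    stage_testField_zero, Finset.mul_sum, mul_add, zero_add]
  congr 1 <;> exact Finset.sum_congr rfl fun j _ => by ring

theorem step_testField_one (m : TwoDerivativeMethod s) (h : ℝ) :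
    m.step testField testFieldDot h 0 1 =
      h ^ 3 * (∑ j, m.b j * (m.abscissa j ^ 2 / 2) + ∑ j, m.bhat j * m.abscissa j) := by
  rw [step]
  simp only [testFieldDot_eq, testField, Pi.add_apply, Pi.smul_apply,
    Finset.sum_apply, smul_eq_mul, Matrix.cons_val_one, Matrix.cons_val_zero,
    stage_testField_zero, Finset.mul_sum, mul_add, zero_add]
  congr 1 <;> exact Finset.sum_congr rfl fun j _ => by ring

theorem step_testField_two (m : TwoDerivativeMethod s) (h : ℝ) :
    m.step testField testFieldDot h 0 2 =
      h ^ 7 * ∑ j, m.b j * (m.cubicCoeff j - m.abscissa j ^ 3 / 6) ^ 2 := by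
  rw [step]
  simp only [testFieldDot_eq, testField, Pi.add_apply, Pi.smul_apply, Finset.sum_apply,
    smul_eq_mul, Matrix.cons_val, stage_testField_zero, stage_testField_one,
    Finset.mul_sum, zero_add, mul_zero, Finset.sum_const_zero, add_zero]
  exact Finset.sum_congr rfl fun j _ => by ring

theorem eq_zero_of_pow_mul_isBigO {k n : ℕ} (hkn : k < n) {C : ℝ}
    (h : (fun t : ℝ => t ^ k * C) =O[𝓝[>] (0 : ℝ)] fun t : ℝ => t ^ n) : C = 0 := by
  have h1 : (fun t : ℝ => t ^ k * C) =o[𝓝[>] (0 : ℝ)] fun t : ℝ => t ^ k :=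
    h.trans_isLittleO ((isLittleO_pow_pow hkn).mono nhdsWithin_le_nhds)
  have h2 := h1.tendsto_div_nhds_zero
  refine tendsto_nhds_unique (tendsto_const_nhds.congr' ?_) h2
  filter_upwards [self_mem_nhdsWithin] with t ht
  have : t ^ k ≠ 0 := pow_ne_zero _ (ne_of_gt ht)
  field_simp

/-- The order conditions that the test system yields for a method of order seven. -/
theorem HasOrder.testField_conditions {m : TwoDerivativeMethod s} (h : m.HasOrder 7) :
    ∑ j, m.b j * (m.abscissa j ^ 2 / 2) + ∑ j, m.bhat j * m.abscissa j = 1 / 6 ∧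
      ∑ j, m.b j * (m.cubicCoeff j - m.abscissa j ^ 3 / 6) ^ 2 = 0 := by
  have h0 := h 3 testField contDiff_testField (fun t => ![t, t ^ 3 / 6, 0])
    (Eventually.of_forall fun t => by
      rw [hasDerivAt_pi]
      intro i
      fin_cases i
      · exact hasDerivAt_id t
      · refine ((hasDerivAt_pow 3 t).div_const 6).congr_deriv ?_
        simp [testField]
        ring
      · simpa [testField] using hasDerivAt_const t (0 : ℝ))
  have hu : (![0, 0 ^ 3 / 6, 0] : Fin 3 → ℝ) = 0 := by
    ext i
    fin_cases i <;> simp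
  simp only [hu] at h0
  rw [isBigO_pi] at h0
  constructor
  · refine sub_eq_zero.1 (eq_zero_of_pow_mul_isBigO (k := 3) (n := 8) (by norm_num) ?_)
    refine (h0 1).congr_left fun t => ?_
    have := m.step_testField_one t
    rw [Pi.sub_apply]
    refine (congrArg (· - t ^ 3 / 6) this).trans ?_
    ring
  -- The error is a pure `h⁷` term, just below the `O(h⁸)` of order seven; order six would not
  -- constrain it.
  · refine eq_zero_of_pow_mul_isBigO (k := 7) (n := 8) (by norm_num) ?_
    refine (h0 2).congr_left fun t => ?_
    have := m.step_testField_two t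
    rw [Pi.sub_apply]
    exact (congrArg (· - (0 : ℝ)) this).trans (sub_zero _)

/-- If all stages satisfy the stage condition of order three, then all abscissae vanish: the
first nonzero abscissa would violate it. -/
theorem abscissa_eq_zero (m : TwoDerivativeMethod s)
    (h : ∀ i, m.cubicCoeff i = m.abscissa i ^ 3 / 6) (i : Fin s) : m.abscissa i = 0 := by
  induction i using WellFoundedLT.induction with
  | ind i ih =>
    have hz : m.cubicCoeff i = 0 := by
      have h1 : ∀ j, m.A i j * (m.abscissa j ^ 2 / 2) = 0 := fun j => by
        rcases lt_or_ge j i with hj | hj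
        · simp [ih j hj]
        · simp [m.A_explicit i j hj]
      have h2 : ∀ j, m.Ahat i j * m.abscissa j = 0 := fun j => by
        rcases lt_or_ge j i with hj | hj
        · simp [ih j hj]
        · simp [m.Ahat_explicit i j hj]
      simp [cubicCoeff, h1, h2]
    have h3 := h i
    rw [hz] at h3
    exact pow_eq_zero_iff (n := 3) (by norm_num) |>.1 (by linarith)

/-- A sum of squares with positive weights vanishes only termwise. Then all abscissae are zero, and
the cubic order condition reads `0 = 1 / 6`. -/
theorem not_hasOrder_seven_of_b_pos {m : TwoDerivativeMethod s} (hb : ∀ j, 0 < m.b j) :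
    ¬ m.HasOrder 7 := by
  intro h
  obtain ⟨h1, h2⟩ := h.testField_conditions
  have h3 : ∀ i, m.abscissa i = 0 := m.abscissa_eq_zero fun i => by
    have h4 := (Finset.sum_eq_zero_iff_of_nonneg fun j _ =>
      mul_nonneg (hb j).le (sq_nonneg _)).1 h2 i (Finset.mem_univ i)
    have h5 := (mul_eq_zero.1 h4).resolve_left (hb i).ne'
    exact sub_eq_zero.1 (pow_eq_zero_iff two_ne_zero |>.1 h5)
  simp [h3] at h1

theorem HasOrder.mono {m : TwoDerivativeMethod s} {p q : ℕ} (hqp : q ≤ p) (h : m.HasOrder p) :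
    m.HasOrder q := by
  intro d F hF u hu
  refine (h d F hF u hu).trans (IsBigO.mono ?_ nhdsWithin_le_nhds)
  rcases hqp.eq_or_lt with rfl | hlt
  · exact isBigO_refl _ _
  · exact (isLittleO_pow_pow (by omega)).isBigO

end TestProblem

end TwoDerivativeMethod

theorem mainTheorem3 (s : ℕ) (m : TwoDerivativeMethod s) (K : ℝ) (hK : 0 < K)
    (hirr : m.IsIrreducible) (hssp : m.IsSSPTS K) :
    ¬ m.HasOrder 7 ∧ ∀ p : ℕ, m.HasOrder p → p ≤ 6 := by
  have h7 : ¬ m.HasOrder 7 :=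
    TwoDerivativeMethod.not_hasOrder_seven_of_b_pos (hssp.b_pos hK hirr)
  refine ⟨h7, fun p hp => ?_⟩
  by_contra! hlt
  exact h7 (hp.mono (by omega))
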